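/- For an oriented link diagram $D$ in the plane, let $H_D(v,z)\in\mathbb{Z}[v^{\pm1},z^{\pm1}]$ be its framed Homfly polynomial, that is, the regular isotopy invariant of (non-empty) oriented link diagrams which is uniquely determined by the skein relations $$H_{D_+}-H_{D_-}=z\,H_{D_0},\qquad H_{D^{\text{neg. kink}}}=v\,H_{D},\qquad H_{D^{\text{pos. kink}}}=v^{-1}H_{D},$$ and $H_{\bigcirc}=1$ for the crossingless diagram of the unknot. (Here $D_+,D_-,D_0$ agree except near one crossing, which is positive in $D_+$, negative in $D_-$ and smoothed according to orientation in $D_0$; and $D^{\text{neg. kink}}$, $D^{\text{pos. kink}}$ arise from $D$ by inserting a kink with a negative or positive crossing.) The Homfly polynomial is $P_D(v,z)=v^{w(D)}H_D(v,z)$, where $w(D)$ is the writhe of $D$. Let $n\ge 1$, let $B_n$ be the braid group on $n$ strands with standard generators $\sigma_1,\dots,\sigma_{n-1}$ (positive crossings), and let $\Delta=(\sigma_1\sigma_2\cdots\sigma_{n-1})(\sigma_1\cdots\sigma_{n-2})\cdots(\sigma_1\sigma_2)\,\sigma_1\in B_n$ be the Garside half twist. For a braid $\gamma\in B_n$ let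 $P_{\widehat\gamma}$ be the Homfly polynomial of the closure $\widehat\gamma$ (the diagram obtained by closing any braid word for $\gamma$ with $n$ disjoint simple arcs, with the strands of the braid oriented in parallel from left to right). **Theorem.** For every braid $\beta\in B_n$ with exponent sum $w$, $$\text{the coefficient of } v^{w-n+1} \text{ in } P_{\widehat{\beta}}(v,z)\;=\;(-1)^{n-1}\cdot\text{the coefficient of } v^{w+n^2-1}\text{ in }P_{\widehat{\beta\Delta^2}}(v,z),$$ where both coefficients are Laurent polynomials in $z$ with integer coefficients. -/

import Mathlib

open scoped LaurentPolynomial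

/-! ### Braid groups -/

namespace Braid

/-- Artin's relations among the generators `σ_0, …, σ_{n-2}` of the braid group on `n` strands:
`σ_i σ_j = σ_j σ_i` for `|i - j| ≥ 2` and `σ_i σ_{i+1} σ_i = σ_{i+1} σ_i σ_{i+1}`. -/
def artinRelations (n : ℕ) : Set (FreeGroup (Fin (n - 1))) :=
  {x | ∃ i j : Fin (n - 1), (i : ℕ) + 2 ≤ j ∧
    x = FreeGroup.of i * FreeGroup.of j * (FreeGroup.of j * FreeGroup.of i)⁻¹} ∪
  {x | ∃ i j : Fin (n - 1), (i : ℕ) + 1 = j ∧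
    x = FreeGroup.of i * FreeGroup.of j * FreeGroup.of i *
      (FreeGroup.of j * FreeGroup.of i * FreeGroup.of j)⁻¹}

/-- The braid group on `n` strands. -/
abbrev BraidGroup (n : ℕ) : Type := PresentedGroup (artinRelations n)

/-- The standard (positive) generator exchanging the adjacent strands `i` and `i + 1`
(strands are numbered from `0`). -/
def sigma {n : ℕ} (i : Fin (n - 1)) : BraidGroup n := PresentedGroup.of i

/-- The Garside half twist
`Δ = (σ_0 σ_1 ⋯ σ_{n-2}) (σ_0 ⋯ σ_{n-3}) ⋯ (σ_0 σ_1) σ_0`. -/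
def halfTwist (n : ℕ) : BraidGroup n :=
  ((List.finRange (n - 1)).reverse.map fun k =>
    (((List.finRange (n - 1)).filter fun i => i ≤ k).map sigma).prod).prod

/-- The exponent sum as a homomorphism: every generator goes to `1 : ℤ`. -/
def exponentSumHom (n : ℕ) : BraidGroup n →* Multiplicative ℤ :=
  PresentedGroup.toGroup (f := fun _ => Multiplicative.ofAdd (1 : ℤ)) (by
    rintro r (⟨i, j, -, rfl⟩ | ⟨i, j, -, rfl⟩) <;> simp)

/-- The exponent sum of a braid. -/
def exponentSum {n : ℕ} (β : BraidGroup n) : ℤ := Multiplicative.toAdd (exponentSumHom n β)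

/-- A braid word: the letter `(i, true)` is `σ_i`, the letter `(i, false)` is `σ_i⁻¹`. -/
abbrev BraidWord (n : ℕ) : Type := List (Fin (n - 1) × Bool)

/-- The braid represented by a braid word. -/
def BraidWord.toBraid {n : ℕ} (b : BraidWord n) : BraidGroup n :=
  (b.map fun x => if x.2 then sigma x.1 else (sigma x.1)⁻¹).prod

end Braid

/-! ### Oriented link diagrams

An oriented link diagram in the plane is put in general position with respect to the horizontal
coordinate and cut by vertical lines into slices that contain one elementary piece each: a local
minimum or maximum of the horizontal coordinate, or a crossing.  The diagram is recorded as the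
list of its slices from left to right.  The strands that meet a vertical line are listed from top
to bottom, by their orientation: `true` for a strand running from left to right, `false` for a
strand running from right to left. -/

namespace LinkDiagram

/-- The elementary pieces of a diagram.
* `birth a`: an arc with two right ends, of which the upper one has orientation `a`.
* `death a`: an arc with two left ends, of which the upper one has orientation `a`.
* `crossing a b s`: two strands cross; the one with orientation `a` descends from top left to
  bottom right, the one with orientation `b` ascends from bottom left to top right; the descending
  one is the overpass if `s = true`, the ascending one if `s = false`. -/
inductive Piece : Type
  | birth (a : Bool)
  | death (a : Bool)
  | crossing (a b s : Bool)

/-- Orientations of the strands at the left side of a piece, from top to bottom. -/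
def Piece.left : Piece → List Bool
  | .birth _ => []
  | .death a => [a, !a]
  | .crossing a b _ => [a, b]

/-- Orientations of the strands at the right side of a piece, from top to bottom. -/
def Piece.right : Piece → List Bool
  | .birth a => [a, !a]
  | .death _ => []
  | .crossing a b _ => [b, a]

/-- The sign of a crossing (`0` for the other pieces).  If both strands run in the same horizontal
direction, the crossing is positive exactly when the descending strand is the overpass; reversing
one of the two strands changes the sign. -/
def Piece.sign : Piece → ℤ
  | .birth _ => 0
  | .death _ => 0
  | .crossing a b s => if s = (a == b) then 1 else -1

/-- A slice: an elementary piece between horizontal strands `above` and `below` it. -/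
structure Slice : Type where
  above : List Bool
  piece : Piece
  below : List Bool

/-- Orientations of the strands at the left side of a slice. -/
def Slice.left (s : Slice) : List Bool := s.above ++ s.piece.left ++ s.below

/-- Orientations of the strands at the right side of a slice. -/
def Slice.right (s : Slice) : List Bool := s.above ++ s.piece.right ++ s.below

/-- `Fits x w y`: the slices in `w` can be glued one after the other (the orientations of the
strands match), `x` and `y` being the orientations at the far left and the far right. -/
def Fits : List Bool → List Slice → List Bool → Prop
  | x, [], y => x = y
  | x, s :: w, y => x = s.left ∧ Fits s.right w y

end LinkDiagram

open LinkDiagram in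
/-- A (non-empty) oriented link diagram. -/
structure LinkDiagram : Type where
  word : List Slice
  nonempty : word ≠ []
  fits : Fits [] word []

namespace LinkDiagram

/-- The local moves that generate regular isotopy of oriented link diagrams (planar isotopy and the
second and third Reidemeister moves, but not the first one).  `l` and `r` stand for the strands
above and below the place where the move is made. -/
inductive Move : List Slice → List Slice → Prop
  /-- Planar isotopy: two pieces, one above the other, exchange their horizontal positions. -/
  | exchange (g h : Piece) (l m r : List Bool) :
      Move [⟨l, g, m ++ h.left ++ r⟩, ⟨l ++ g.right ++ m, h, r⟩]
        [⟨l ++ g.left ++ m, h, r⟩, ⟨l, g, m ++ h.right ++ r⟩]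
  /-- Planar isotopy: straightening a zigzag. -/
  | zigzagBelow (a : Bool) (l r : List Bool) :
      Move [⟨l ++ [a], .birth (!a), r⟩, ⟨l, .death a, a :: r⟩] []
  /-- Planar isotopy: straightening a zigzag. -/
  | zigzagAbove (a : Bool) (l r : List Bool) :
      Move [⟨l, .birth a, a :: r⟩, ⟨l ++ [a], .death (!a), r⟩] []
  /-- Planar isotopy: a strand crossing the lower branch of a left extremum, staying over or
  staying under, is moved to cross the other branch from the other side. -/
  | slideBirth (a c s : Bool) (l r : List Bool) :
      Move [⟨l ++ [c], .birth a, r⟩, ⟨l, .crossing c a s, (!a) :: r⟩]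
        [⟨l, .birth a, c :: r⟩, ⟨l ++ [a], .crossing (!a) c (!s), r⟩]
  /-- Planar isotopy: the same at a right extremum. -/
  | slideDeath (a c s : Bool) (l r : List Bool) :
      Move [⟨l, .crossing a c s, (!a) :: r⟩, ⟨l ++ [c], .death a, r⟩]
        [⟨l ++ [a], .crossing c (!a) (!s), r⟩, ⟨l, .death a, c :: r⟩]
  /-- The second Reidemeister move. -/
  | reidemeisterTwo (a b s : Bool) (l r : List Bool) :
      Move [⟨l, .crossing a b s, r⟩, ⟨l, .crossing b a (!s), r⟩] []
  /-- The third Reidemeister move, for strands with orientations `a`, `b`, `c`; the condition says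
  that the three crossings are not "cyclic", i.e. that one strand lies over the other two and
  one lies under the other two. -/
  | reidemeisterThree (a b c sab sac sbc : Bool) (h : sab = sbc → sac = sab) (l r : List Bool) :
      Move
        [⟨l, .crossing a b sab, c :: r⟩, ⟨l ++ [b], .crossing a c sac, r⟩,
          ⟨l, .crossing b c sbc, a :: r⟩]
        [⟨l ++ [a], .crossing b c sbc, r⟩, ⟨l, .crossing a c sac, b :: r⟩,
          ⟨l ++ [c], .crossing a b sab, r⟩]

/-- The smoothing, compatible with the orientations, of a crossing of strands with orientations
`a` and `b`. -/
def smoothing (a b : Bool) (l r : List Bool) : List Slice :=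
  if a = b then [] else [⟨l, .death a, r⟩, ⟨l, .birth b, r⟩]

/-- A kink with crossing of sign `+` (if `s = true`) or `-` (if `s = false`) on a strand with
orientation `a`, the loop lying below the strand. -/
def kinkBelow (a s : Bool) (l r : List Bool) : List Slice :=
  [⟨l ++ [a], .birth a, r⟩, ⟨l, .crossing a a s, (!a) :: r⟩, ⟨l ++ [a], .death a, r⟩]

/-- A kink as in `kinkBelow`, but with the loop lying above the strand (the loop has the opposite
rotation). -/
def kinkAbove (a s : Bool) (l r : List Bool) : List Slice :=
  [⟨l, .birth (!a), a :: r⟩, ⟨l ++ [!a], .crossing a a s, r⟩, ⟨l, .death (!a), a :: r⟩]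

/-- The writhe: the sum of the signs of the crossings. -/
def writhe (D : LinkDiagram) : ℤ := (D.word.map fun s => s.piece.sign).sum

end LinkDiagram

/-! ### The Homfly polynomial -/

/-- Integer Laurent polynomials in `v` and `z`, as Laurent polynomials in `v` whose coefficients are
Laurent polynomials in `z`. -/
abbrev LaurentVZ : Type := ℤ[T;T⁻¹][T;T⁻¹]

namespace LaurentVZ

/-- The monomial `v ^ k`. -/
noncomputable def v (k : ℤ) : LaurentVZ := LaurentPolynomial.T k

/-- The indeterminate `z`. -/
noncomputable def z : LaurentVZ := LaurentPolynomial.C (LaurentPolynomial.T 1)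

end LaurentVZ

namespace LinkDiagram

/-- The properties that characterize the framed Homfly polynomial `D ↦ H_D`. -/
structure IsFramedHomfly (H : LinkDiagram → LaurentVZ) : Prop where
  /-- `H` is invariant under regular isotopy. -/
  regular_isotopy : ∀ (A B L R : List Slice) (D D' : LinkDiagram), Move L R →
    D.word = A ++ L ++ B → D'.word = A ++ R ++ B → H D = H D'
  /-- `H_{D₊} - H_{D₋} = z H_{D₀}` for diagrams that differ only at one crossing, which is positive
  in `D₊`, negative in `D₋` and smoothed in `D₀`. -/
  skein : ∀ (A B : List Slice) (l r : List Bool) (a b : Bool) (Dpos Dneg Dzero : LinkDiagram),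
    Dpos.word = A ++ [⟨l, .crossing a b (a == b), r⟩] ++ B →
    Dneg.word = A ++ [⟨l, .crossing a b (!(a == b)), r⟩] ++ B →
    Dzero.word = A ++ smoothing a b l r ++ B →
    H Dpos - H Dneg = LaurentVZ.z * H Dzero
  /-- Removing a negative kink divides `H` by `v`, removing a positive kink multiplies it by `v`. -/
  kink : ∀ (A B : List Slice) (l r : List Bool) (a s : Bool) (D D' : LinkDiagram),
    (D.word = A ++ kinkBelow a s l r ++ B ∨ D.word = A ++ kinkAbove a s l r ++ B) →
    D'.word = A ++ B →
    H D = LaurentVZ.v (if s then -1 else 1) * H D'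
  /-- `H = 1` for the crossingless diagram of the unknot, with either orientation. -/
  unknot : ∀ (a : Bool) (D : LinkDiagram),
    D.word = [⟨[], .birth a, []⟩, ⟨[], .death a, []⟩] → H D = 1

open Classical in
/-- The framed Homfly polynomial: the function determined by the skein relations, regular isotopy
invariance and the normalization.  (That it exists and is unique is the classical theorem of
Freyd-Yetter, Hoste, Lickorish-Millett, Ocneanu and Przytycki-Traczyk; the value in the `else`
branch is never taken.) -/
noncomputable def framedHomfly : LinkDiagram → LaurentVZ :=
  if h : ∃ H : LinkDiagram → LaurentVZ, IsFramedHomfly H then h.choose else 0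

/-- The Homfly polynomial `P_D = v^w H_D`, where `w` is the writhe of `D`. -/
noncomputable def homfly (D : LinkDiagram) : LaurentVZ := LaurentVZ.v D.writhe * framedHomfly D

/-! ### Closed braids -/

theorem Fits.append {x y t : List Bool} {w w' : List Slice} (h : Fits x w y) (h' : Fits y w' t) :
    Fits x (w ++ w') t := by
  induction w generalizing x with
  | nil => cases h; exact h'
  | cons s w ih => exact ⟨h.1, ih h.2⟩

/-- The strands of a closed braid at a vertical line through the braid: `n` closing strands running
from right to left, and below them the `n` strands of the braid running from left to right. -/
def closureStrands (n : ℕ) : List Bool := List.replicate n false ++ List.replicate n true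

/-- The left ends of the `n` nested closing arcs, from the outermost to the innermost. -/
def closureLeft (n : ℕ) : List Slice :=
  (List.range n).map fun k => ⟨List.replicate k false, .birth false, List.replicate k true⟩

/-- The right ends of the `n` nested closing arcs, from the innermost to the outermost. -/
def closureRight (n : ℕ) : List Slice :=
  (List.range n).reverse.map fun k =>
    ⟨List.replicate k false, .death false, List.replicate k true⟩

/-- The crossing of a letter `σ_i^{±1}` of a braid word; it lies below the `n` closing strands.
The generator `σ_i` is a positive crossing. -/
def letterSlice {n : ℕ} (x : Fin (n - 1) × Bool) : Slice :=
  ⟨List.replicate n false ++ List.replicate x.1 true, .crossing true true x.2,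
    List.replicate (n - 2 - x.1) true⟩

theorem fits_closureLeft (n : ℕ) : Fits [] (closureLeft n) (closureStrands n) := by
  induction n with
  | zero => rfl
  | succ n ih =>
    rw [closureLeft, List.range_succ, List.map_append]
    refine ih.append ⟨?_, ?_⟩
    · simp [closureStrands, Slice.left, Piece.left]
    · simp [Fits, closureStrands, Slice.right, Piece.right, List.replicate_succ',
        ← List.replicate_succ]

theorem fits_closureRight (n : ℕ) : Fits (closureStrands n) (closureRight n) [] := by
  induction n with
  | zero => rfl
  | succ n ih =>
    rw [closureRight, List.range_succ, List.reverse_append, List.map_append]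
    refine Fits.append (y := closureStrands n) ⟨?_, ?_⟩ ih
    · simp [closureStrands, Slice.left, Piece.left, List.replicate_succ',
        ← List.replicate_succ]
    · simp [Fits, closureStrands, Slice.right, Piece.right]

theorem fits_letters {n : ℕ} (b : Braid.BraidWord n) :
    Fits (closureStrands n) (b.map letterSlice) (closureStrands n) := by
  induction b with
  | nil => rfl
  | cons x b ih =>
    have key : closureStrands n = List.replicate n false ++ List.replicate x.1 true ++
        [true, true] ++ List.replicate (n - 2 - x.1) true := by
      have hx := x.1.isLt
      have h2 : [true, true] = List.replicate 2 true := rfl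
      rw [closureStrands, h2, List.append_assoc, List.append_assoc, List.replicate_append_replicate,
        List.replicate_append_replicate]
      congr 2
      omega
    refine ⟨?_, ?_⟩
    · rw [key]; rfl
    · have : (letterSlice x).right = closureStrands n := by rw [key]; rfl
      rw [this]
      exact ih

/-- The diagram of the closure of a braid word on `n ≥ 1` strands: a diagram of the braid together
with `n` disjoint simple closing arcs above it. -/
def closure {n : ℕ} (hn : 1 ≤ n) (b : Braid.BraidWord n) : LinkDiagram where
  word := closureLeft n ++ b.map letterSlice ++ closureRight n
  nonempty := by
    obtain ⟨m, rfl⟩ := Nat.exists_eq_add_of_le' hn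
    simp [closureLeft]
  fits := ((fits_closureLeft n).append (fits_letters b)).append (fits_closureRight n)

end LinkDiagram

namespace Braid

/-! ### The braid group on `m + 1` strands -/

/-! On closed braids the framed polynomial gives functions f_m on the braid group on m + 1 strands
which satisfy the skein relation and are multiplied by v⁻¹ or v when a strand is added with one
positive or negative crossing (`exists_isFramedMarkovTrace`). Only these properties and f_0(1) = 1
are used, never uniqueness. Since P = v^w H and Δ² has exponent sum n(n - 1), for n = m + 1 the
theorem says that the coefficient of v^(-m) in f_m(x) is (-1)^m times that of v^m in f_m(xΔ²)
(`coeff_halfTwist_sq`).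

For a fixed power of v, the coefficient is a skein function, i.e. a linear functional on the Hecke
algebra, so identities need only be tested on a spanning set. If H is the subalgebra on all strands
but the first, the whole algebra is H + H σ_0⁻¹ H (`IsSkein.eq_zero`). This yields by induction the
Morton-Franks-Williams bound, that f_m lives in v-degrees -m to m, and then the identity itself.

On H σ_0⁻¹ H both extreme coefficients vanish. A negative stabilization shifts degrees up, away from
the bottom one. The full twist is the full twist of the other strands times a loop σ_0 ⋯ σ_0 of the
first strand (`halfTwist_sq_succ`), which turns σ_0⁻¹ into σ_0, and a positive stabilization shifts
degrees down, away from the top one.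

On H, the relation z f_{m+1}(shift a) = (v⁻¹ - v) f_m(a) expresses the two extreme coefficients with
opposite signs, whence (-1)^m. The loop can be dropped there: the top coefficient kills H σ_0 H, and
σ_0² = 1 + zσ_0 then makes the loop indistinguishable from 1 (`IsSkein.loop_eq`). -/

/-- The generator `σ_i` of the braid group on `m + 1` strands. -/
def gen {m : ℕ} (i : Fin m) : BraidGroup (m + 1) := sigma (n := m + 1) i

theorem gen_comm {m : ℕ} {i j : Fin m} (h : (i : ℕ) + 2 ≤ j) :
    gen i * gen j = gen j * gen i := by
  have hr : FreeGroup.of i * FreeGroup.of j * (FreeGroup.of j * FreeGroup.of i)⁻¹ ∈ artinRelations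
      (m + 1) :=
    Or.inl ⟨i, j, h, rfl⟩
  have := PresentedGroup.mk_eq_one_iff.2 (Subgroup.subset_normalClosure hr)
  rw [map_mul, map_inv, mul_inv_eq_one] at this
  simp only [map_mul] at this
  exact this

theorem commute_gen {m : ℕ} {i j : Fin m} (h : (i : ℕ) + 2 ≤ j) : Commute (gen i) (gen j) :=
  gen_comm h

theorem gen_braid {m : ℕ} {i j : Fin m} (h : (i : ℕ) + 1 = j) :
    gen i * gen j * gen i = gen j * gen i * gen j := by
  have hr : FreeGroup.of i * FreeGroup.of j * FreeGroup.of i *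
      (FreeGroup.of j * FreeGroup.of i * FreeGroup.of j)⁻¹ ∈ artinRelations (m + 1) :=
    Or.inr ⟨i, j, h, rfl⟩
  have := PresentedGroup.mk_eq_one_iff.2 (Subgroup.subset_normalClosure hr)
  rw [map_mul, map_inv, mul_inv_eq_one] at this
  simp only [map_mul] at this
  exact this

@[elab_as_elim]
theorem gen_induction {m : ℕ} {p : BraidGroup (m + 1) → Prop} (one : p 1)
    (mul_gen : ∀ x i, p x → p (x * gen i)) (mul_inv_gen : ∀ x i, p x → p (x * (gen i)⁻¹))
    (x : BraidGroup (m + 1)) : p x := by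
  have hx : x ∈ Subgroup.closure (Set.range (gen (m := m))) := by
    have := PresentedGroup.closure_range_of (artinRelations (m + 1))
    exact this ▸ Subgroup.mem_top x
  induction hx using Subgroup.closure_induction_right with
  | one => exact one
  | mul_right x y _ hy h =>
    obtain ⟨i, rfl⟩ := hy
    exact mul_gen x i h
  | mul_inv_cancel x y _ hy h =>
    obtain ⟨i, rfl⟩ := hy
    exact mul_inv_gen x i h

/-- A homomorphism out of the braid group, given by elements that satisfy Artin's relations. -/
def liftGen {m : ℕ} {G : Type*} [Group G] (f : Fin m → G)
    (comm : ∀ i j : Fin m, (i : ℕ) + 2 ≤ j → f i * f j = f j * f i)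
    (braid : ∀ i j : Fin m, (i : ℕ) + 1 = j → f i * f j * f i = f j * f i * f j) :
    BraidGroup (m + 1) →* G :=
  PresentedGroup.toGroup (rels := artinRelations (m + 1)) (f := f) (by
    rintro r (⟨i, j, h, rfl⟩ | ⟨i, j, h, rfl⟩)
    · simpa [-mul_inv_rev, mul_inv_eq_one] using comm i j h
    · simpa [-mul_inv_rev, mul_inv_eq_one] using braid i j h)

@[simp]
theorem liftGen_gen {m : ℕ} {G : Type*} [Group G] (f : Fin m → G) (comm braid) (i : Fin m) :
    liftGen f comm braid (gen i) = f i :=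
  PresentedGroup.toGroup.of _

/-- The embedding of braid groups that adds a strand before the others. -/
def shift {m : ℕ} : BraidGroup (m + 1) →* BraidGroup (m + 2) :=
  liftGen (fun i => gen i.succ)
    (fun i j h => gen_comm (by simp only [Fin.val_succ]; omega))
    (fun i j h => gen_braid (by simp only [Fin.val_succ]; omega))

/-- The embedding of braid groups that adds a strand after the others. -/
def extend {m : ℕ} : BraidGroup (m + 1) →* BraidGroup (m + 2) :=
  liftGen (fun i => gen i.castSucc)
    (fun i j h => gen_comm (by simpa using h))
    (fun i j h => gen_braid (by simpa using h))

@[simp]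
theorem shift_gen {m : ℕ} (i : Fin m) : shift (gen i) = gen i.succ := liftGen_gen ..

@[simp]
theorem extend_gen {m : ℕ} (i : Fin m) : extend (gen i) = gen i.castSucc := liftGen_gen ..

theorem gen_zero_comm_shift_shift {m : ℕ} (x : BraidGroup (m + 1)) :
    gen 0 * shift (shift x) = shift (shift x) * gen 0 := by
  change Commute _ _
  induction x using gen_induction with
  | one => simp
  | mul_gen x i h =>
    rw [map_mul, map_mul]
    refine h.mul_right ?_
    rw [shift_gen, shift_gen]
    exact commute_gen (by simp)
  | mul_inv_gen x i h =>
    rw [map_mul, map_mul, map_inv, map_inv]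
    refine h.mul_right ?_
    rw [shift_gen, shift_gen]
    exact (commute_gen (by simp)).inv_right

theorem gen_last_comm_extend_extend {m : ℕ} (x : BraidGroup (m + 1)) :
    gen (Fin.last (m + 1)) * extend (extend x) = extend (extend x) * gen (Fin.last (m + 1)) := by
  change Commute _ _
  induction x using gen_induction with
  | one => simp
  | mul_gen x i h =>
    rw [map_mul, map_mul]
    refine h.mul_right ?_
    rw [extend_gen, extend_gen]
    exact (commute_gen (by simp)).symm
  | mul_inv_gen x i h =>
    rw [map_mul, map_mul, map_inv, map_inv]
    refine h.mul_right ?_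
    rw [extend_gen, extend_gen]
    exact (commute_gen (by simp)).symm.inv_right

theorem gen_braid_zero {m : ℕ} :
    (gen 0 * gen 1 * gen 0 : BraidGroup (m + 3)) = gen 1 * gen 0 * gen 1 :=
  gen_braid (by simp)

theorem shift_gen_zero {m : ℕ} : shift (gen 0) = (gen 1 : BraidGroup (m + 3)) := shift_gen 0

instance : Subsingleton (BraidGroup (0 + 1)) where
  allEq x y := by
    have h : ∀ x : BraidGroup (0 + 1), x = 1 := fun x => by
      induction x using gen_induction with
      | one => rfl
      | mul_gen x i => exact i.elim0
      | mul_inv_gen x i => exact i.elim0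
    rw [h x, h y]

/-! ### The full twist -/

/-- The positive braid in which the first strand runs once around all the others. -/
def loop : (m : ℕ) → BraidGroup (m + 1)
  | 0 => 1
  | m + 1 => gen 0 * shift (loop m) * gen 0

/-- Only σ_1 interacts with the outer letters: in σ_0 σ_1 y σ_1 σ_0 the core y commutes with σ_0, so
two braid relations carry σ_1 across. Later generators commute with σ_0 and pass the inner loop by
induction. -/
theorem loop_comm_shift {m : ℕ} (x : BraidGroup (m + 1)) :
    loop (m + 1) * shift x = shift x * loop (m + 1) := by
  induction m with
  | zero =>
    obtain rfl := Subsingleton.elim x 1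
    simp
  | succ m ih =>
    have key : ∀ i, Commute (loop (m + 2)) (gen (Fin.succ i)) := by
      intro i
      cases i using Fin.cases with
      | zero =>
        have h0 := gen_zero_comm_shift_shift (loop m)
        have hb := gen_braid_zero (m := m)
        rw [commute_iff_eq, loop, loop, map_mul, map_mul, shift_gen_zero, Fin.succ_zero_eq_one]
        generalize shift (shift (loop m)) = y at h0
        calc _ = gen 0 * gen 1 * y * (gen 1 * gen 0 * gen 1) := by simp only [mul_assoc]
          _ = gen 0 * gen 1 * y * gen 0 * gen 1 * gen 0 := by rw [← hb]; simp only [mul_assoc]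
          _ = gen 0 * gen 1 * (gen 0 * y) * gen 1 * gen 0 := by rw [h0]; simp only [mul_assoc]
          _ = gen 0 * gen 1 * gen 0 * y * gen 1 * gen 0 := by simp only [mul_assoc]
          _ = _ := by rw [hb]; simp only [mul_assoc]
      | succ i =>
        have h1 : Commute (gen 0) (gen i.succ.succ : BraidGroup (m + 3)) := gen_comm (by simp)
        refine .mul_left (.mul_left h1 ?_) h1
        rw [← shift_gen, ← shift_gen, commute_iff_eq, ← map_mul, ← map_mul, ih]
    change Commute _ _
    induction x using gen_induction with
    | one => simp
    | mul_gen x i h =>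
      rw [map_mul, shift_gen]
      exact h.mul_right (key i)
    | mul_inv_gen x i h =>
      rw [map_mul, map_inv, shift_gen]
      exact h.mul_right (key i).inv_right

/-- The braid `σ_0 σ_1 ⋯ σ_{m-1}`. -/
def staircase (m : ℕ) : BraidGroup (m + 1) := ((List.finRange m).map gen).prod

/-- The braid `σ_{m-1} ⋯ σ_1 σ_0`. -/
def staircaseRev (m : ℕ) : BraidGroup (m + 1) := ((List.finRange m).reverse.map gen).prod

theorem map_list_gen_prod {m k : ℕ} (f : BraidGroup (m + 1) →* BraidGroup (k + 1))
    (g : Fin m → Fin k)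
    (h : ∀ i, f (gen i) = gen (g i)) (l : List (Fin m)) :
    f (l.map gen).prod = ((l.map g).map gen).prod := by
  rw [map_list_prod, List.map_map, List.map_map]
  congr 2
  exact funext h

theorem staircase_succ (m : ℕ) : staircase (m + 1) = gen 0 * shift (staircase m) := by
  rw [staircase, staircase, map_list_gen_prod shift _ shift_gen, List.finRange_succ]
  simp

theorem staircaseRev_succ (m : ℕ) : staircaseRev (m + 1) = shift (staircaseRev m) * gen 0 := by
  rw [staircaseRev, staircaseRev, map_list_gen_prod shift _ shift_gen, List.finRange_succ]
  simp

theorem staircase_succ_last (m : ℕ) :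
    staircase (m + 1) = extend (staircase m) * gen (Fin.last m) := by
  rw [staircase, staircase, map_list_gen_prod extend _ extend_gen, List.finRange_succ_last]
  simp

theorem staircaseRev_succ_last (m : ℕ) :
    staircaseRev (m + 1) = gen (Fin.last m) * extend (staircaseRev m) := by
  rw [staircaseRev, staircaseRev, map_list_gen_prod extend _ extend_gen, List.finRange_succ_last]
  simp

theorem staircase_mul_staircaseRev (m : ℕ) : staircase m * staircaseRev m = loop m := by
  induction m with
  | zero => exact Subsingleton.elim (α := BraidGroup (0 + 1)) _ _
  | succ m ih =>
    rw [staircase_succ, staircaseRev_succ, loop, ← ih, map_mul]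
    simp only [mul_assoc]

/-- Conjugation by σ_0 ⋯ σ_m raises the index of a generator by one: for σ_0 this is the braid
relation, and for the others σ_0 is peeled off the staircase. -/
theorem staircase_mul_extend {m : ℕ} (x : BraidGroup (m + 1)) :
    staircase (m + 1) * extend x = shift x * staircase (m + 1) := by
  have key : ∀ {m : ℕ} (i : Fin m),
      staircase (m + 1) * gen i.castSucc = gen i.succ * staircase (m + 1) := by
    intro m i
    induction m with
    | zero => exact i.elim0
    | succ m ih =>
      cases i using Fin.cases with
      | zero =>
        rw [staircase_succ, staircase_succ, map_mul, shift_gen_zero, Fin.castSucc_zero,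
          Fin.succ_zero_eq_one, mul_assoc, mul_assoc, ← gen_zero_comm_shift_shift, ← mul_assoc,
          ← mul_assoc, ← mul_assoc, ← mul_assoc, gen_braid_zero]
      | succ i =>
        rw [staircase_succ, Fin.castSucc_succ, ← shift_gen i.castSucc, mul_assoc, ← map_mul, ih,
          map_mul, shift_gen, ← mul_assoc, ← mul_assoc]
        congr 1
        exact gen_comm (by simp)
  change SemiconjBy _ _ _
  induction x using gen_induction with
  | one => simp
  | mul_gen x i h =>
    rw [map_mul, map_mul, extend_gen, shift_gen]
    exact h.mul_right (key i)
  | mul_inv_gen x i h =>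
    rw [map_mul, map_mul, map_inv, map_inv, extend_gen, shift_gen]
    exact h.mul_right (SemiconjBy.inv_right (key i))

/-- The first factor of Δ is the full staircase; the other factors avoid the last generator. -/
theorem halfTwist_succ (m : ℕ) :
    halfTwist (m + 2) = staircase (m + 1) * extend (halfTwist (m + 1)) := by
  change ((List.finRange (m + 1)).reverse.map fun k =>
    (((List.finRange (m + 1)).filter fun i => i ≤ k).map gen).prod).prod =
    _ * extend (((List.finRange m).reverse.map fun k =>
    (((List.finRange m).filter fun i => i ≤ k).map gen).prod).prod)
  rw [List.finRange_succ_last, List.reverse_append, List.map_append, List.prod_append,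
    ← List.finRange_succ_last, map_list_prod, ← List.map_reverse, List.map_map, List.map_map]
  congr 1
  · rw [staircase]
    simp [Fin.le_last]
  · congr 2
    funext k
    simp only [Function.comp_apply]
    rw [map_list_gen_prod extend _ extend_gen, List.finRange_succ_last, List.filter_append,
      List.filter_map]
    have : ¬ Fin.last m ≤ k.castSucc := not_le.2 (Fin.castSucc_lt_last k)
    simp [this, Function.comp_def]

/-- The mirror factorization follows by induction, because the last generator commutes with the half
twist on two fewer strands. -/
theorem halfTwist_succ_eq_extend_mul (m : ℕ) :
    halfTwist (m + 2) = extend (halfTwist (m + 1)) * staircaseRev (m + 1) := by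
  induction m with
  | zero =>
    have h (x : BraidGroup (0 + 1)) : x = 1 := Subsingleton.elim _ _
    rw [halfTwist_succ, staircase_succ, staircaseRev_succ, h (halfTwist _), h (staircase _),
      h (staircaseRev _)]
    simp
  | succ m ih =>
    calc halfTwist (m + 3) = staircase (m + 2) * extend (halfTwist (m + 2)) := halfTwist_succ _
      _ = extend (staircase (m + 1)) * (gen (Fin.last (m + 1)) *
          extend (extend (halfTwist (m + 1)))) * extend (staircaseRev (m + 1)) := by
        rw [ih, staircase_succ_last, map_mul]
        simp only [mul_assoc]
      _ = extend (staircase (m + 1) * extend (halfTwist (m + 1))) *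
          (gen (Fin.last (m + 1)) * extend (staircaseRev (m + 1))) := by
        rw [gen_last_comm_extend_extend, map_mul]
        simp only [mul_assoc]
      _ = _ := by rw [← halfTwist_succ, ← staircaseRev_succ_last]

/-- Writing the left factor with `staircase` and the right one with `staircaseRev` brings the two
smaller half twists together; moving them to the left leaves `staircase * staircaseRev`, which is
the loop. -/
theorem halfTwist_sq_succ (m : ℕ) :
    halfTwist (m + 2) ^ 2 = shift (halfTwist (m + 1) ^ 2) * loop (m + 1) := by
  rw [sq]
  nth_rewrite 1 [halfTwist_succ]
  rw [halfTwist_succ_eq_extend_mul, staircase_mul_extend, ← staircase_mul_staircaseRev, mul_assoc,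
    ← mul_assoc (staircase _), staircase_mul_extend, sq, map_mul]
  simp only [mul_assoc]

/-! ### Skein functions on braid groups -/

/-- A function on a braid group that satisfies the Homfly skein relation. -/
def IsSkein {m : ℕ} {K : Type*} [CommRing K] (z : K) (φ : BraidGroup (m + 1) → K) : Prop :=
  ∀ a b i, φ (a * gen i * b) - φ (a * (gen i)⁻¹ * b) = z * φ (a * b)

namespace IsSkein

variable {m : ℕ} {K : Type*} [CommRing K] {z : K} {φ : BraidGroup (m + 1) → K}

theorem translate (hφ : IsSkein z φ) (x y : BraidGroup (m + 1)) :
    IsSkein z fun b => φ (x * b * y) := fun a b i => by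
  simpa only [mul_assoc] using hφ (x * a) (b * y) i

theorem translate_shift {φ : BraidGroup (m + 2) → K} (hφ : IsSkein z φ) (x y : BraidGroup (m + 2)) :
    IsSkein z fun b => φ (x * shift b * y) := fun a b i => by
  simpa only [mul_assoc, map_mul, map_inv, shift_gen] using hφ (x * shift a) (shift b * y) i.succ

theorem sub_mul {ψ : BraidGroup (m + 1) → K} (hφ : IsSkein z φ) (hψ : IsSkein z ψ) (c : K) :
    IsSkein z fun b => φ b - c * ψ b := fun a b i => by
  linear_combination hφ a b i - c * hψ a b i

/-- Vanishing on H and on H σ_0⁻¹ H is stable under right translation of φ by a generator or its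
inverse, so the letters of x are absorbed into φ one by one. The hypothesis `step` isolates the one
hard case, H σ_0⁻¹ H σ_0. -/
theorem eq_zero_of_gen_zero {φ : BraidGroup (m + 2) → K} (hφ : IsSkein z φ)
    (h : ∀ a, φ (shift a) = 0) (h' : ∀ a b, φ (shift a * (gen 0)⁻¹ * shift b) = 0)
    (step : ∀ φ : BraidGroup (m + 2) → K, IsSkein z φ → (∀ a, φ (shift a) = 0) →
      (∀ a b, φ (shift a * (gen 0)⁻¹ * shift b) = 0) →
      ∀ a b, φ (shift a * (gen 0)⁻¹ * shift b * gen 0) = 0) (x : BraidGroup (m + 2)) :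
    φ x = 0 := by
  have mul_gen : ∀ {φ : BraidGroup (m + 2) → K}, IsSkein z φ → (∀ a, φ (shift a) = 0) →
      (∀ a b, φ (shift a * (gen 0)⁻¹ * shift b) = 0) → ∀ i, (∀ a, φ (shift a * gen i) = 0) ∧
      ∀ a b, φ (shift a * (gen 0)⁻¹ * shift b * gen i) = 0 := by
    intro φ hφ h h' i
    cases i using Fin.cases with
    | zero =>
      refine ⟨fun a => ?_, step φ hφ h h'⟩
      have h1 := hφ (shift a) 1 0
      have h2 := h' a 1
      simp only [map_one, mul_one] at h1 h2
      linear_combination h1 + h2 + z * h a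
    | succ i =>
      refine ⟨fun a => ?_, fun a b => ?_⟩
      · rw [← shift_gen, ← map_mul]
        exact h _
      · rw [← shift_gen, mul_assoc, ← map_mul]
        exact h' _ _
  have inv_eq_zero : ∀ {φ : BraidGroup (m + 2) → K}, IsSkein z φ → ∀ a i, φ a = 0 →
      φ (a * gen i) = 0 → φ (a * (gen i)⁻¹) = 0 := by
    intro φ hφ a i h h'
    have := hφ a 1 i
    simp only [mul_one] at this
    linear_combination h' - this - z * h
  induction x using gen_induction generalizing φ with
  | one => simpa using h 1
  | mul_gen x i ih =>
    exact ih (φ := fun x => φ (x * gen i)) (by simpa using hφ.translate 1 (gen i))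
      (mul_gen hφ h h' i).1 (mul_gen hφ h h' i).2
  | mul_inv_gen x i ih =>
    exact ih (φ := fun x => φ (x * (gen i)⁻¹)) (by simpa using hφ.translate 1 (gen i)⁻¹)
      (fun a => inv_eq_zero hφ _ i (h a) ((mul_gen hφ h h' i).1 a))
      (fun a b => inv_eq_zero hφ _ i (h' a b) ((mul_gen hφ h h' i).2 a b))

/-- The Hecke algebra on `m + 2` strands is the sum `H + H σ_0⁻¹ H`, where `H` is the Hecke algebra
on the last `m + 1` strands. -/
theorem eq_zero {φ : BraidGroup (m + 2) → K} (hφ : IsSkein z φ) (h : ∀ a, φ (shift a) = 0)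
    (h' : ∀ a b, φ (shift a * (gen 0)⁻¹ * shift b) = 0) (x : BraidGroup (m + 2)) : φ x = 0 := by
  induction m with
  | zero =>
    refine hφ.eq_zero_of_gen_zero h h' (fun φ _ h _ a b => ?_) x
    obtain rfl := Subsingleton.elim b 1
    simpa using h a
  | succ m ih =>
    refine hφ.eq_zero_of_gen_zero h h' (fun φ hφ h h' a => ?_) x
    -- The middle factor of σ_0⁻¹ H σ_0 is itself decomposed by the induction hypothesis. If it
    -- avoids σ_1, the outer letters cancel; otherwise the braid relation leaves a single σ_0⁻¹.
    refine ih (hφ.translate_shift (shift a * (gen 0)⁻¹) (gen 0)) (fun c => ?_) (fun c d => ?_)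
    · rw [mul_assoc, ← gen_zero_comm_shift_shift, mul_assoc, inv_mul_cancel_left, ← map_mul]
      exact h _
    · have hc : Commute (gen 0) (shift (shift c)) := gen_zero_comm_shift_shift c
      have hd := gen_zero_comm_shift_shift d
      have hb : (gen 0)⁻¹ * (gen 1)⁻¹ * gen 0 =
          (gen 1 * (gen 0)⁻¹ * (gen 1)⁻¹ : BraidGroup (m + 3)) := by
        have := gen_braid_zero (m := m)
        rw [← mul_inv_rev, inv_mul_eq_iff_eq_mul, ← mul_assoc, ← mul_assoc, eq_mul_inv_iff_mul_eq,
          eq_mul_inv_iff_mul_eq, this]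
      have := h' (a * shift c * gen 0) ((gen 0)⁻¹ * shift d)
      rw [map_mul, map_mul, map_mul, map_inv, shift_gen_zero] at this
      rw [← this, map_mul, map_mul, map_inv, shift_gen_zero]
      congr 1
      calc _ = shift a * ((gen 0)⁻¹ * shift (shift c)) * (gen 1)⁻¹ *
            (shift (shift d) * gen 0) := by simp only [mul_assoc]
        _ = shift a * shift (shift c) * ((gen 0)⁻¹ * (gen 1)⁻¹ * gen 0) * shift (shift d) := by
          rw [hc.inv_left.eq, ← hd]; simp only [mul_assoc]
        _ = _ := by rw [hb]; simp only [mul_assoc]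

theorem gen_zero_sq_eq {φ : BraidGroup (m + 2) → K} (hφ : IsSkein z φ)
    (h : ∀ a b, φ (shift a * gen 0 * shift b) = 0) : φ (gen 0 * gen 0) = φ 1 := by
  have h0 := h 1 1
  have := hφ (gen 0) 1 0
  simp only [map_one, one_mul, mul_one, mul_inv_cancel] at h0 this
  linear_combination this + z * h0

/-- A skein function that vanishes on `H σ_0 H` does not distinguish `loop` from the trivial
braid. -/
theorem loop_eq {φ : BraidGroup (m + 2) → K} (hφ : IsSkein z φ)
    (h : ∀ a b, φ (shift a * gen 0 * shift b) = 0) : φ (loop (m + 1)) = φ 1 := by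
  induction m with
  | zero => simpa [loop] using hφ.gen_zero_sq_eq h
  | succ m ih =>
    -- The loop is peeled from inside: y ↦ φ(σ_0 · shift y · σ_0) again satisfies the hypothesis,
    -- since σ_0 σ_1 σ_0 = σ_1 σ_0 σ_1 contains σ_0 once. What remains is φ(σ_0²).
    refine (ih (hφ.translate_shift (gen 0) (gen 0)) (fun a b => ?_)).trans ?_
    · rw [map_mul, map_mul, shift_gen_zero]
      have ha := gen_zero_comm_shift_shift a
      have hb := gen_zero_comm_shift_shift b
      have := h (shift a * gen 0) (gen 0 * shift b)
      rw [map_mul, map_mul, shift_gen_zero] at this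
      rw [← this]
      congr 1
      calc _ = gen 0 * shift (shift a) * gen 1 * (shift (shift b) * gen 0) := by
            simp only [mul_assoc]
        _ = shift (shift a) * (gen 0 * gen 1 * gen 0) * shift (shift b) := by
            rw [ha, ← hb]; simp only [mul_assoc]
        _ = _ := by rw [gen_braid_zero]; simp only [mul_assoc]
    · simpa using hφ.gen_zero_sq_eq h

end IsSkein
end Braid

/-! ### Coefficients of powers of v -/

namespace LaurentVZ

open LaurentPolynomial

theorem coeff_z_mul (p : LaurentVZ) (k : ℤ) : (z * p).coeff k = T 1 * p.coeff k := by
  rw [z, ← smul_eq_C_mul, AddMonoidAlgebra.coeff_smul_apply, smul_eq_mul]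

theorem coeff_v_mul (j : ℤ) (p : LaurentVZ) (k : ℤ) : (v j * p).coeff k = p.coeff (k - j) := by
  have := AddMonoidAlgebra.coeff_single_mul_apply p (1 : ℤ[T;T⁻¹]) j k
  rw [one_mul] at this
  rw [v, sub_eq_neg_add]
  exact this

theorem coeff_sub (p q : LaurentVZ) (k : ℤ) : (p - q).coeff k = p.coeff k - q.coeff k := rfl

theorem T_one_mul_cancel {p q : ℤ[T;T⁻¹]} (h : T 1 * p = T 1 * q) : p = q :=
  (isUnit_T 1).mul_left_cancel h

end LaurentVZ

/-! ### Framed Markov traces and their extreme coefficients -/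

namespace Braid

open LaurentVZ LaurentPolynomial

/-- A family of functions on the braid groups with the properties of the framed Homfly polynomial of
closed braids: the skein relation and invariance up to framing under stabilization. -/
structure IsFramedMarkovTrace (f : ∀ m, BraidGroup (m + 1) → LaurentVZ) : Prop where
  skein : ∀ m, IsSkein z (f m)
  pos : ∀ m a b, f (m + 1) (shift a * gen 0 * shift b) = v (-1) * f m (a * b)
  neg : ∀ m a b, f (m + 1) (shift a * (gen 0)⁻¹ * shift b) = v 1 * f m (a * b)

namespace IsFramedMarkovTrace

variable {f : ∀ m, BraidGroup (m + 1) → LaurentVZ}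

/-- The skein relation at σ_0 compares the two stabilizations; its smoothing is the braid with a
split strand. -/
theorem z_mul_shift (hf : IsFramedMarkovTrace f) {m : ℕ} (a : BraidGroup (m + 1)) :
    z * f (m + 1) (shift a) = v (-1) * f m a - v 1 * f m a := by
  have h1 := hf.pos m a 1
  have h2 := hf.neg m a 1
  have h3 := hf.skein (m + 1) (shift a) 1 0
  simp only [map_one, mul_one] at h1 h2 h3
  rw [← h3, h1, h2]

theorem isSkein_coeff (hf : IsFramedMarkovTrace f) (m : ℕ) (k : ℤ) : IsSkein (T 1) fun b =>
    (f m b).coeff k := fun a b i => by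
  change _ = T 1 * (f m (a * b)).coeff k
  rw [← coeff_z_mul, ← hf.skein m a b i]
  rfl

theorem coeff_shift (hf : IsFramedMarkovTrace f) {m : ℕ} (a : BraidGroup (m + 1)) (k : ℤ) :
    T 1 * (f (m + 1) (shift a)).coeff k = (f m a).coeff (k + 1) - (f m a).coeff (k - 1) := by
  rw [← coeff_z_mul, hf.z_mul_shift, coeff_sub, coeff_v_mul, coeff_v_mul, sub_neg_eq_add]

theorem coeff_pos (hf : IsFramedMarkovTrace f) {m : ℕ} (a b : BraidGroup (m + 1)) (k : ℤ) :
    (f (m + 1) (shift a * gen 0 * shift b)).coeff k = (f m (a * b)).coeff (k + 1) := by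
  rw [hf.pos, coeff_v_mul, sub_neg_eq_add]

theorem coeff_neg (hf : IsFramedMarkovTrace f) {m : ℕ} (a b : BraidGroup (m + 1)) (k : ℤ) :
    (f (m + 1) (shift a * (gen 0)⁻¹ * shift b)).coeff k = (f m (a * b)).coeff (k - 1) := by
  rw [hf.neg, coeff_v_mul]

/-- The Morton and Franks-Williams bounds for the `v`-degrees. -/
theorem coeff_eq_zero (hf : IsFramedMarkovTrace f) {m : ℕ} (hm : ∀ k : ℤ, 0 < |k| → (f 0 1).coeff k = 0)
    (x : BraidGroup (m + 1)) {k : ℤ} (hk : m < |k|) : (f m x).coeff k = 0 := by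
  induction m generalizing k with
  | zero =>
    obtain rfl := Subsingleton.elim x 1
    exact hm k (by simpa using hk)
  | succ m ih =>
    have h1 : (m : ℤ) < |k + 1| := by grind
    have h2 : (m : ℤ) < |k - 1| := by grind
    refine (hf.isSkein_coeff (m + 1) k).eq_zero (fun a => T_one_mul_cancel ?_) (fun a b => ?_) x
    · rw [hf.coeff_shift, ih a h1, ih a h2, sub_zero, mul_zero]
    · exact (hf.coeff_neg a b k).trans (ih _ h2)

/-- The extreme coefficients in degrees `-m` and `m` are exchanged by the full twist. -/
theorem coeff_halfTwist_sq (hf : IsFramedMarkovTrace f) {m : ℕ}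
    (hm : ∀ k : ℤ, 0 < |k| → (f 0 1).coeff k = 0)
    (x : BraidGroup (m + 1)) :
    (f m x).coeff (-m) = (-1) ^ m * (f m (x * halfTwist (m + 1) ^ 2)).coeff m := by
  induction m with
  | zero =>
    rw [Subsingleton.elim (x * halfTwist (0 + 1) ^ 2) x]
    simp
  | succ m ih =>
    have high {k : ℤ} (hk : m < |k|) (y : BraidGroup (m + 1)) : (f m y).coeff k = 0 :=
      hf.coeff_eq_zero hm y hk
    have hpos : (m : ℤ) < |((m + 1 : ℕ) : ℤ) + 1| := by push_cast; grind
    have hneg : (m : ℤ) < |(-(m + 1 : ℕ) : ℤ) - 1| := by push_cast; grind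
    have vanish (a b : BraidGroup (m + 1)) :
        (f (m + 1) (shift a * gen 0 * shift b)).coeff (m + 1 : ℕ) = 0 :=
      (hf.coeff_pos a b _).trans (high hpos _)
    have hsk : IsSkein (T 1) fun y =>
        (f (m + 1) (y * halfTwist (m + 2) ^ 2)).coeff ((m + 1 : ℕ) : ℤ) := by
      simpa using (hf.isSkein_coeff (m + 1) (m + 1 : ℕ)).translate 1 (halfTwist (m + 2) ^ 2)
    refine sub_eq_zero.1 (((hf.isSkein_coeff (m + 1) (-(m + 1 : ℕ) : ℤ)).sub_mul hsk
      ((-1) ^ (m + 1))).eq_zero (fun a => ?_) (fun a b => ?_) x)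
    -- Braids in H: the loop is removed in top degree, then the split-strand relation reduces both
    -- sides to one strand fewer.
    · have hl : (f (m + 1) (shift a * halfTwist (m + 2) ^ 2)).coeff ((m + 1 : ℕ) : ℤ) =
          (f (m + 1) (shift (a * halfTwist (m + 1) ^ 2))).coeff ((m + 1 : ℕ) : ℤ) := by
        have := ((hf.isSkein_coeff (m + 1) (m + 1 : ℕ)).translate
          (shift (a * halfTwist (m + 1) ^ 2)) 1).loop_eq fun c d => by
            have := vanish (a * halfTwist (m + 1) ^ 2 * c) d
            rw [map_mul] at this
            simpa only [mul_one, mul_assoc] using this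
        rw [halfTwist_sq_succ, ← mul_assoc, ← map_mul]
        simpa only [mul_one] using this
      refine T_one_mul_cancel ?_
      change T 1 * (_ - _ * (f (m + 1) (shift a * halfTwist (m + 2) ^ 2)).coeff _) = _
      have h1 := hf.coeff_shift a (-(m + 1 : ℕ) : ℤ)
      have h2 := hf.coeff_shift (a * halfTwist (m + 1) ^ 2) ((m + 1 : ℕ) : ℤ)
      rw [high hneg] at h1
      rw [high hpos] at h2
      have e1 : (-(m + 1 : ℕ) : ℤ) + 1 = -m := by push_cast; ring
      have e2 : ((m + 1 : ℕ) : ℤ) - 1 = m := by push_cast; ring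
      rw [e1] at h1
      rw [e2] at h2
      rw [hl]
      -- Each split-strand relation has one term outside the degree bounds. The surviving terms have
      -- opposite signs, turning (-1)^m into (-1)^(m+1).
      linear_combination h1 - (-1) ^ (m + 1) * h2 + ih a
    -- The loop, being central for H, is moved next to σ_0⁻¹ and cancels it, leaving one σ_0.
    · have hb : (gen 0)⁻¹ * shift b * halfTwist (m + 2) ^ 2 =
          shift (loop m) * gen 0 * shift (b * halfTwist (m + 1) ^ 2) := by
        rw [halfTwist_sq_succ, mul_assoc, ← mul_assoc (shift b), ← map_mul, ← loop_comm_shift, loop]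
        simp only [mul_assoc, inv_mul_cancel_left]
      have h1 := vanish (a * loop m) (b * halfTwist (m + 1) ^ 2)
      have h2 := (hf.coeff_neg a b (-(m + 1 : ℕ) : ℤ)).trans (high hneg _)
      change _ - _ * (f (m + 1) (shift a * (gen 0)⁻¹ * shift b * halfTwist (m + 2) ^ 2)).coeff _ = 0
      rw [map_mul, mul_assoc, mul_assoc, ← mul_assoc (shift (loop m)), ← hb, ← mul_assoc,
        ← mul_assoc] at h1
      rw [h2, h1]
      simp

end IsFramedMarkovTrace

/-! ### The exponent sum of the full twist -/

theorem exponentSum_mul {n : ℕ} (x y : BraidGroup n) :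
    exponentSum (x * y) = exponentSum x + exponentSum y := by
  rw [exponentSum, map_mul, toAdd_mul]
  rfl

theorem exponentSum_gen {m : ℕ} (i : Fin m) : exponentSum (gen i) = 1 := by
  rw [exponentSum, exponentSumHom, gen, sigma, PresentedGroup.toGroup.of]
  rfl

theorem exponentSum_inv {n : ℕ} (x : BraidGroup n) : exponentSum x⁻¹ = -exponentSum x := by
  rw [exponentSum, map_inv, toAdd_inv]
  rfl

theorem exponentSum_one {n : ℕ} : exponentSum (1 : BraidGroup n) = 0 := by
  rw [exponentSum, map_one, toAdd_one]

theorem exponentSum_extend {m : ℕ} (x : BraidGroup (m + 1)) :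
    exponentSum (extend x) = exponentSum x := by
  induction x using gen_induction with
  | one => rw [map_one, exponentSum_one, exponentSum_one]
  | mul_gen x i h =>
    rw [map_mul, exponentSum_mul, exponentSum_mul, h, extend_gen, exponentSum_gen, exponentSum_gen]
  | mul_inv_gen x i h =>
    rw [map_mul, map_inv, exponentSum_mul, exponentSum_mul, exponentSum_inv, exponentSum_inv, h,
      extend_gen, exponentSum_gen, exponentSum_gen]

theorem exponentSum_staircase (m : ℕ) : exponentSum (staircase m) = m := by
  induction m with
  | zero => exact exponentSum_one
  | succ m ih =>
    rw [staircase_succ_last, exponentSum_mul, exponentSum_extend, ih, exponentSum_gen]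
    push_cast
    rfl

theorem exponentSum_halfTwist_sq (m : ℕ) :
    exponentSum (halfTwist (m + 1) ^ 2) = m * (m + 1) := by
  rw [sq, exponentSum_mul]
  induction m with
  | zero =>
    rw [Subsingleton.elim (halfTwist (0 + 1)) 1, exponentSum_one]
    simp
  | succ m ih =>
    rw [halfTwist_succ, exponentSum_mul, exponentSum_extend, exponentSum_staircase]
    push_cast
    linear_combination ih

/-! ### Braid words and functions invariant under Artin's relations -/

theorem toBraid_append {n : ℕ} (u v : BraidWord n) :
    BraidWord.toBraid (u ++ v) = BraidWord.toBraid u * BraidWord.toBraid v := by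
  rw [BraidWord.toBraid, List.map_append, List.prod_append]
  rfl

theorem toBraid_cons {n : ℕ} (x : Fin (n - 1) × Bool) (u : BraidWord n) :
    BraidWord.toBraid (x :: u) = BraidWord.toBraid [x] * BraidWord.toBraid u :=
  toBraid_append [x] u

/-- The letter `σ_i` (if `s = true`) or `σ_i⁻¹` (if `s = false`). -/
abbrev letter {m : ℕ} (i : Fin m) (s : Bool) : Fin (m + 1 - 1) × Bool := (i, s)

theorem toBraid_pos {m : ℕ} (i : Fin m) : BraidWord.toBraid (n := m + 1) [letter i true] = gen i
    := by
  rw [BraidWord.toBraid, List.map_singleton, List.prod_singleton]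
  rfl

theorem toBraid_neg {m : ℕ} (i : Fin m) :
    BraidWord.toBraid (n := m + 1) [letter i false] = (gen i)⁻¹ := by
  rw [BraidWord.toBraid, List.map_singleton, List.prod_singleton]
  rfl

theorem exists_toBraid_eq {m : ℕ} (x : BraidGroup (m + 1)) :
    ∃ u : BraidWord (m + 1), u.toBraid = x := by
  induction x using gen_induction with
  | one => exact ⟨[], rfl⟩
  | mul_gen x i h =>
    obtain ⟨u, rfl⟩ := h
    exact ⟨u ++ [letter i true], by rw [toBraid_append, toBraid_pos]⟩
  | mul_inv_gen x i h =>
    obtain ⟨u, rfl⟩ := h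
    exact ⟨u ++ [letter i false], by rw [toBraid_append, toBraid_neg]⟩

/-- A function of braid words that is invariant under Artin's relations is a function of the
braid. -/
theorem eq_of_toBraid_eq {m : ℕ} {S : Type*} (F : BraidWord (m + 1) → S)
    (cancel : ∀ (a b : BraidWord (m + 1)) (i : Fin m) (s : Bool),
      F (a ++ [letter i s, letter i (!s)] ++ b) = F (a ++ [] ++ b))
    (comm : ∀ (a b : BraidWord (m + 1)) (i j : Fin m), (i : ℕ) + 2 ≤ j →
      F (a ++ [letter i true, letter j true] ++ b) = F (a ++ [letter j true, letter i true] ++ b))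
    (braid : ∀ (a b : BraidWord (m + 1)) (i j : Fin m), (i : ℕ) + 1 = j →
      F (a ++ [letter i true, letter j true, letter i true] ++ b) =
        F (a ++ [letter j true, letter i true, letter j true] ++ b))
    {u u' : BraidWord (m + 1)} (h : u.toBraid = u'.toBraid) : F u = F u' := by
  -- Words are identified when F agrees after every common prefix. Prepending letters then makes the
  -- braid group act on the quotient, and a braid sends the empty word to the class of any word for
  -- it.
  let r : Setoid (BraidWord (m + 1)) :=
    { r := fun u v => ∀ a, F (a ++ u) = F (a ++ v)
      iseqv := ⟨fun _ _ => rfl, fun h a => (h a).symm, fun h h' a => (h a).trans (h' a)⟩ }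
  let c (i : Fin m) (s : Bool) : Quotient r → Quotient r :=
    Quotient.map (List.cons (letter i s)) fun u v h a => by simpa using h (a ++ [letter i s])
  have hc (i : Fin m) (s : Bool) (q : Quotient r) : c i s (c i (!s) q) = q := by
    induction q using Quotient.inductionOn with
    | h u => exact Quotient.sound fun a => by simpa using cancel a u i s
  let p (i : Fin m) : Equiv.Perm (Quotient r) :=
    ⟨c i true, c i false, hc i false, hc i true⟩
  let φ : BraidGroup (m + 1) →* Equiv.Perm (Quotient r) := liftGen p
    (fun i j h => Equiv.ext fun q => by
      induction q using Quotient.inductionOn with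
      | h u => exact Quotient.sound fun a => by simpa using comm a u i j h)
    (fun i j h => Equiv.ext fun q => by
      induction q using Quotient.inductionOn with
      | h u => exact Quotient.sound fun a => by simpa using braid a u i j h)
  have key (u : BraidWord (m + 1)) : φ u.toBraid ⟦[]⟧ = ⟦u⟧ := by
    induction u with
    | nil =>
      change φ 1 ⟦[]⟧ = _
      rw [map_one]
      rfl
    | cons x u ih =>
      rw [toBraid_cons, map_mul, Equiv.Perm.mul_apply, ih]
      obtain ⟨i, _ | _⟩ := x
      · rw [toBraid_neg, map_inv, liftGen_gen]
        rfl
      · rw [toBraid_pos, liftGen_gen]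
        rfl
  exact Quotient.exact ((key u).symm.trans (h ▸ key u')) []

/-- The braid word in which every strand is replaced by the next one. -/
def shiftWord {m : ℕ} (u : BraidWord (m + 1)) : BraidWord (m + 2) :=
  u.map fun x => (Fin.succ (n := m) x.1, x.2)

theorem toBraid_shiftWord {m : ℕ} (u : BraidWord (m + 1)) :
    (shiftWord u).toBraid = shift u.toBraid := by
  induction u with
  | nil => exact (map_one shift).symm
  | cons x u ih =>
    rw [shiftWord, List.map_cons, toBraid_cons, toBraid_cons x, map_mul, ← ih]
    obtain ⟨i, _ | _⟩ := x
    · erw [toBraid_neg, toBraid_neg, map_inv, shift_gen]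
      rfl
    · erw [toBraid_pos, toBraid_pos, shift_gen]
      rfl

end Braid

/-! ### From diagrams of closed braids to Markov traces -/

namespace LinkDiagram

open Braid

theorem fits_append_iff {x y : List Bool} {w w' : List Slice} :
    Fits x (w ++ w') y ↔ ∃ t, Fits x w t ∧ Fits t w' y := by
  refine ⟨fun h => ?_, fun ⟨t, h, h'⟩ => h.append h'⟩
  induction w generalizing x with
  | nil => exact ⟨x, rfl, h⟩
  | cons s w ih =>
    obtain ⟨t, ht, ht'⟩ := ih h.2
    exact ⟨t, ⟨h.1, ht⟩, ht'⟩

theorem fits_exchange (g h : Piece) (l m r x y : List Bool) :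
    Fits x [⟨l, g, m ++ h.left ++ r⟩, ⟨l ++ g.right ++ m, h, r⟩] y ↔
      Fits x [⟨l ++ g.left ++ m, h, r⟩, ⟨l, g, m ++ h.right ++ r⟩] y := by
  simp [Fits, Slice.left, Slice.right]

section Invariant

variable {H : LinkDiagram → LaurentVZ}

/-- `regular_isotopy` compares two given diagrams, so the exchanged word must first be shown to fit.
-/
theorem IsFramedHomfly.exists_exchange (hH : IsFramedHomfly H) (g h : Piece) (l m r : List Bool) {D
    : LinkDiagram}
    {A B : List Slice} (hD : D.word = A ++
      [⟨l, g, m ++ h.left ++ r⟩, ⟨l ++ g.right ++ m, h, r⟩] ++ B) :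
    ∃ D' : LinkDiagram, D'.word = A ++
      [⟨l ++ g.left ++ m, h, r⟩, ⟨l, g, m ++ h.right ++ r⟩] ++ B ∧ H D = H D' := by
  have hf := D.fits
  rw [hD] at hf
  obtain ⟨y, hf, hB⟩ := fits_append_iff.1 hf
  obtain ⟨x, hA, hf⟩ := fits_append_iff.1 hf
  refine ⟨⟨_, by simp, (hA.append ((fits_exchange g h l m r x y).1 hf)).append hB⟩, rfl, ?_⟩
  exact hH.regular_isotopy _ _ _ _ _ _ (.exchange g h l m r) hD rfl

theorem IsFramedHomfly.exists_exchange_symm (hH : IsFramedHomfly H) (g h : Piece)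
    (l m r : List Bool) {D : LinkDiagram}
    {A B : List Slice} (hD : D.word = A ++
      [⟨l ++ g.left ++ m, h, r⟩, ⟨l, g, m ++ h.right ++ r⟩] ++ B) :
    ∃ D' : LinkDiagram, D'.word = A ++
      [⟨l, g, m ++ h.left ++ r⟩, ⟨l ++ g.right ++ m, h, r⟩] ++ B ∧ H D = H D' := by
  have hf := D.fits
  rw [hD] at hf
  obtain ⟨y, hf, hB⟩ := fits_append_iff.1 hf
  obtain ⟨x, hA, hf⟩ := fits_append_iff.1 hf
  refine ⟨⟨_, by simp, (hA.append ((fits_exchange g h l m r x y).2 hf)).append hB⟩, rfl, ?_⟩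
  exact (hH.regular_isotopy _ _ _ _ _ _ (.exchange g h l m r) rfl hD).symm

end Invariant

/-! ### Letters of braid words -/

theorem letterSlice_comm {m : ℕ} (i j : Fin m) (h : (i : ℕ) + 2 ≤ j) (s t : Bool) :
    Move [letterSlice (n := m + 1) (letter i s), letterSlice (n := m + 1) (letter j t)]
      [letterSlice (n := m + 1) (letter j t), letterSlice (n := m + 1) (letter i s)] := by
  have hj := j.isLt
  have := Move.exchange (.crossing true true s) (.crossing true true t)
    (List.replicate (m + 1) false ++ List.replicate i true) (List.replicate (j - i - 2) true)
    (List.replicate (m + 1 - 2 - j) true)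
  have h1 : List.replicate (j - i - 2) true ++ [true, true] ++ List.replicate (m + 1 - 2 - j) true =
      List.replicate (m + 1 - 2 - i) true := by
    rw [show [true, true] = List.replicate 2 true from rfl, List.replicate_append_replicate,
      List.replicate_append_replicate]
    congr 1
    omega
  have h2 : List.replicate (m + 1) false ++ List.replicate i true ++ [true, true] ++
      List.replicate (j - i - 2) true = List.replicate (m + 1) false ++ List.replicate j true := by
    rw [show [true, true] = List.replicate 2 true from rfl, List.append_assoc, List.append_assoc,
      List.replicate_append_replicate, List.replicate_append_replicate]
    congr 2
    omega
  simp only [Piece.left, Piece.right, h1, h2] at this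
  exact this

theorem letterSlice_braid {m : ℕ} (i j : Fin m) (h : (i : ℕ) + 1 = j) :
    Move [letterSlice (n := m + 1) (letter i true), letterSlice (n := m + 1) (letter j true),
        letterSlice (n := m + 1) (letter i true)]
      [letterSlice (n := m + 1) (letter j true), letterSlice (n := m + 1) (letter i true),
        letterSlice (n := m + 1) (letter j true)] := by
  have hj := j.isLt
  have := Move.reidemeisterThree true true true true true true (fun _ => rfl)
    (List.replicate (m + 1) false ++ List.replicate i true) (List.replicate (m + 1 - 2 - j) true)
  have h1 : true :: List.replicate (m + 1 - 2 - j) true = List.replicate (m + 1 - 2 - i) true := by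
    rw [← List.replicate_succ]
    congr 1
    omega
  have h2 : List.replicate (m + 1) false ++ List.replicate i true ++ [true] =
      List.replicate (m + 1) false ++ List.replicate j true := by
    rw [List.append_assoc, ← List.replicate_succ', h]
  simp only [h1, h2] at this
  exact this

theorem writhe_closure {n : ℕ} (hn : 1 ≤ n) (u : BraidWord n) :
    (closure hn u).writhe = exponentSum u.toBraid := by
  obtain ⟨m, rfl⟩ := Nat.exists_eq_add_of_le' hn
  have hl : ((closureLeft (m + 1)).map fun s => s.piece.sign).sum = 0 :=
    List.sum_eq_zero (by simp [closureLeft, Piece.sign])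
  have hr : ((closureRight (m + 1)).map fun s => s.piece.sign).sum = 0 :=
    List.sum_eq_zero (by simp [closureRight, Piece.sign])
  have hu : ((u.map letterSlice).map fun s => s.piece.sign).sum = exponentSum u.toBraid := by
    induction u with
    | nil => exact exponentSum_one.symm
    | cons x u ih =>
      rw [toBraid_cons, exponentSum_mul, ← ih, List.map_cons, List.map_cons, List.sum_cons]
      congr 1
      obtain ⟨i, _ | _⟩ := x
      · erw [toBraid_neg, exponentSum_inv, exponentSum_gen]
        rfl
      · erw [toBraid_pos, exponentSum_gen]
        rfl
  rw [writhe, closure, List.map_append, List.map_append, List.sum_append, List.sum_append, hl, hr,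
    hu, zero_add, add_zero]

section Trace

variable {H : LinkDiagram → LaurentVZ}

theorem IsFramedHomfly.closure_congr (hH : IsFramedHomfly H) {n : ℕ} (hn : 1 ≤ n) {L R
    : BraidWord n}
    (h : Move (L.map letterSlice) (R.map letterSlice)) (a b : BraidWord n) :
    H (closure hn (a ++ L ++ b)) = H (closure hn (a ++ R ++ b)) :=
  hH.regular_isotopy (closureLeft n ++ a.map letterSlice) (b.map letterSlice ++ closureRight n)
    _ _ _ _ h (by simp [closure]) (by simp [closure])

theorem IsFramedHomfly.closure_eq (hH : IsFramedHomfly H) {n : ℕ} (hn : 1 ≤ n) {u u' : BraidWord n}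
    (h : u.toBraid = u'.toBraid) : H (closure hn u) = H (closure hn u') := by
  obtain ⟨m, rfl⟩ := Nat.exists_eq_add_of_le' hn
  refine eq_of_toBraid_eq (fun u => H (closure hn u)) (fun a b i s => ?_) (fun a b i j h => ?_)
    (fun a b i j h => ?_) h
  · exact hH.closure_congr hn (L := [letter i s, letter i (!s)]) (R := [])
      (.reidemeisterTwo true true s _ _) a b
  · exact hH.closure_congr hn (L := [letter i true, letter j true])
      (R := [letter j true, letter i true]) (letterSlice_comm i j h true true) a b
  · exact hH.closure_congr hn (L := [letter i true, letter j true, letter i true])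
      (R := [letter j true, letter i true, letter j true]) (letterSlice_braid i j h) a b

/-- The innermost arc closes the first strand, which a shifted word never touches, so its left end
slides past the word by planar isotopy. -/
theorem IsFramedHomfly.exists_birth_swap (hH : IsFramedHomfly H) {m : ℕ} (u : BraidWord (m + 1))
    {A B : List Slice}
    {D : LinkDiagram} (hD : D.word = A ++
      ⟨List.replicate (m + 1) false, .birth false, List.replicate (m + 1) true⟩ ::
        (shiftWord u).map letterSlice ++ B) :
    ∃ D' : LinkDiagram, D'.word = A ++ u.map letterSlice ++
      ⟨List.replicate (m + 1) false, .birth false, List.replicate (m + 1) true⟩ :: B ∧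
        H D = H D' := by
  induction u generalizing A D with
  | nil => exact ⟨D, by simpa [shiftWord] using hD, rfl⟩
  | cons x u ih =>
    obtain ⟨i, s⟩ := x
    change Fin m at i
    have hi := i.isLt
    have h1 : List.replicate i true ++ [true, true] ++ List.replicate (m + 1 - 2 - i) true =
        List.replicate (m + 1) true := by
      rw [show [true, true] = List.replicate 2 true from rfl, List.replicate_append_replicate,
        List.replicate_append_replicate]
      congr 1
      omega
    have h2 : List.replicate (m + 1) false ++ [false, true] ++ List.replicate i true =
        List.replicate (m + 2) false ++ List.replicate (i + 1) true := by
      rw [List.replicate_succ' (n := m + 1), List.replicate_succ (n := i)]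
      simp
    have h3 : m - (i + 1) = m - 1 - i := by omega
    obtain ⟨D', hD', h'⟩ := hH.exists_exchange (D := D) (A := A) (.birth false)
      (.crossing true true s) (List.replicate (m + 1) false) (List.replicate i true)
      (List.replicate (m + 1 - 2 - i) true) (B := (shiftWord u).map letterSlice ++ B) (by
        simp only [Piece.left, Piece.right, Bool.not_false, h1, h2]
        rw [hD]
        simp [shiftWord, letterSlice, h3])
    obtain ⟨D'', hD'', h''⟩ := ih (A := A ++ [letterSlice (n := m + 1) (letter i s)]) (D := D') (by
      simp only [Piece.left, Piece.right, h1] at hD'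
      rw [hD']
      simp [letterSlice])
    exact ⟨D'', by rw [hD'']; simp, h'.trans h''⟩

theorem IsFramedHomfly.exists_death_swap (hH : IsFramedHomfly H) {m : ℕ} (u : BraidWord (m + 1))
    {A B : List Slice}
    {D : LinkDiagram} (hD : D.word = A ++ (shiftWord u).map letterSlice ++
      ⟨List.replicate (m + 1) false, .death false, List.replicate (m + 1) true⟩ :: B) :
    ∃ D' : LinkDiagram, D'.word = A ++
      ⟨List.replicate (m + 1) false, .death false, List.replicate (m + 1) true⟩ ::
        u.map letterSlice ++ B ∧ H D = H D' := by
  induction u using List.reverseRecOn generalizing B D with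
  | nil => exact ⟨D, by simpa [shiftWord] using hD, rfl⟩
  | append_singleton u x ih =>
    obtain ⟨i, s⟩ := x
    change Fin m at i
    have hi := i.isLt
    have h1 : List.replicate i true ++ [true, true] ++ List.replicate (m + 1 - 2 - i) true =
        List.replicate (m + 1) true := by
      rw [show [true, true] = List.replicate 2 true from rfl, List.replicate_append_replicate,
        List.replicate_append_replicate]
      congr 1
      omega
    have h2 : List.replicate (m + 1) false ++ [false, true] ++ List.replicate i true =
        List.replicate (m + 2) false ++ List.replicate (i + 1) true := by
      rw [List.replicate_succ' (n := m + 1), List.replicate_succ (n := i)]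
      simp
    have h3 : m - (i + 1) = m - 1 - i := by omega
    obtain ⟨D', hD', h'⟩ := hH.exists_exchange_symm (D := D) (B := B) (.death false)
      (.crossing true true s) (List.replicate (m + 1) false) (List.replicate i true)
      (List.replicate (m + 1 - 2 - i) true) (A := A ++ (shiftWord u).map letterSlice) (by
        simp only [Piece.left, Piece.right, Bool.not_false, h1, h2]
        rw [hD]
        simp [shiftWord, letterSlice, h3])
    obtain ⟨D'', hD'', h''⟩ := ih (B := letterSlice (n := m + 1) (letter i s) :: B) (D := D') (by
      simp only [Piece.left, Piece.right, h1] at hD'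
      rw [hD']
      simp [letterSlice])
    exact ⟨D'', by rw [hD'']; simp, h'.trans h''⟩

/-- Both ends of the innermost arc are slid inwards until only the crossing lies between them; this
is a kink with its loop above. Hence strands are added first, by `shift`, and not last. -/
theorem IsFramedHomfly.closure_stabilization (hH : IsFramedHomfly H) {m : ℕ}
    (a b : BraidWord (m + 1)) (s : Bool) :
    H (closure (n := m + 2) (by omega) (shiftWord a ++ [letter (0 : Fin (m + 1)) s] ++ shiftWord b)) =
      LaurentVZ.v (if s then -1 else 1) * H (closure (by omega) (a ++ b)) := by
  have hl : closureLeft (m + 2) = closureLeft (m + 1) ++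
      [⟨List.replicate (m + 1) false, .birth false, List.replicate (m + 1) true⟩] := by
    rw [closureLeft, List.range_succ, List.map_append]
    rfl
  have hr : closureRight (m + 2) =
      ⟨List.replicate (m + 1) false, .death false, List.replicate (m + 1) true⟩ ::
        closureRight (m + 1) := by
    rw [closureRight, List.range_succ, List.reverse_append, List.map_append]
    rfl
  obtain ⟨D, hD, h⟩ := hH.exists_birth_swap a (A := closureLeft (m + 1))
    (D := closure (n := m + 2) (by omega) (shiftWord a ++ [letter (0 : Fin (m + 1)) s] ++ shiftWord b))
    (B := letterSlice (n := m + 2) (letter (0 : Fin (m + 1)) s) :: (shiftWord b).map letterSlice ++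
      closureRight (m + 2)) (by simp [closure, hl])
  obtain ⟨D', hD', h'⟩ := hH.exists_death_swap b (D := D) (B := closureRight (m + 1))
    (A := closureLeft (m + 1) ++ a.map letterSlice ++
      [⟨List.replicate (m + 1) false, .birth false, List.replicate (m + 1) true⟩,
      letterSlice (n := m + 2) (letter (0 : Fin (m + 1)) s)]) (by rw [hD, hr]; simp)
  rw [h, h']
  refine hH.kink (closureLeft (m + 1) ++ a.map letterSlice)
    (b.map letterSlice ++ closureRight (m + 1)) (List.replicate (m + 1) false)
    (List.replicate m true) true s _ _ (.inr ?_) (by simp [closure])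
  rw [hD']
  have h1 : List.replicate (m + 2) false = List.replicate (m + 1) false ++ [false] :=
    List.replicate_succ'
  have h2 : List.replicate (m + 1) true = true :: List.replicate m true := List.replicate_succ
  simp [kinkAbove, letterSlice, h1, h2]

theorem IsFramedHomfly.exists_isFramedMarkovTrace (hH : IsFramedHomfly H) :
    ∃ f : ∀ m, BraidGroup (m + 1) → LaurentVZ, IsFramedMarkovTrace f ∧ f 0 1 = 1 ∧
      ∀ m (u : BraidWord (m + 1)), H (closure (Nat.le_add_left 1 m) u) = f m u.toBraid := by
  let f (m : ℕ) (x : BraidGroup (m + 1)) : LaurentVZ :=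
    H (closure (Nat.le_add_left 1 m) (exists_toBraid_eq x).choose)
  have hf (m) (u : BraidWord (m + 1)) : H (closure (Nat.le_add_left 1 m) u) = f m u.toBraid :=
    hH.closure_eq _ (exists_toBraid_eq u.toBraid).choose_spec.symm
  refine ⟨f, ⟨fun m x y i => ?_, fun m x y => ?_, fun m x y => ?_⟩, ?_, hf⟩
  · obtain ⟨u, rfl⟩ := exists_toBraid_eq x
    obtain ⟨w, rfl⟩ := exists_toBraid_eq y
    rw [← toBraid_neg, ← toBraid_pos, ← toBraid_append, ← toBraid_append, ← toBraid_append,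
      ← toBraid_append, ← toBraid_append, ← hf, ← hf, ← hf]
    exact hH.skein (closureLeft (m + 1) ++ u.map letterSlice)
      (w.map letterSlice ++ closureRight (m + 1))
      (List.replicate (m + 1) false ++ List.replicate i true) (List.replicate (m + 1 - 2 - i) true)
      true true _ _ _ (by simp [closure, letterSlice]) (by simp [closure, letterSlice])
      (by simp [closure, smoothing])
  · obtain ⟨u, rfl⟩ := exists_toBraid_eq x
    obtain ⟨w, rfl⟩ := exists_toBraid_eq y
    rw [← toBraid_shiftWord, ← toBraid_shiftWord, ← toBraid_pos, ← toBraid_append,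
      ← toBraid_append, ← toBraid_append, ← hf, ← hf]
    exact hH.closure_stabilization u w true
  · obtain ⟨u, rfl⟩ := exists_toBraid_eq x
    obtain ⟨w, rfl⟩ := exists_toBraid_eq y
    rw [← toBraid_shiftWord, ← toBraid_shiftWord, ← toBraid_neg, ← toBraid_append,
      ← toBraid_append, ← toBraid_append, ← hf, ← hf]
    exact hH.closure_stabilization u w false
  · exact (hf 0 []).symm.trans (hH.unknot false _ rfl)

end Trace

end LinkDiagram

open LinkDiagram Braid LaurentVZ in
/-- `b` and `b'` are arbitrary braid words for `β` and `βΔ²`. -/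
theorem mainTheorem1 (n : ℕ) (hn : 1 ≤ n) (β : Braid.BraidGroup n) (b b' : Braid.BraidWord n)
    (hb : b.toBraid = β) (hb' : b'.toBraid = β * Braid.halfTwist n ^ 2) :
    (LinkDiagram.closure hn b).homfly.coeff (Braid.exponentSum β - n + 1) =
      (-1) ^ (n - 1) *
        (LinkDiagram.closure hn b').homfly.coeff (Braid.exponentSum β + (n : ℤ) ^ 2 - 1) := by
  rw [homfly, homfly, writhe_closure, writhe_closure, coeff_v_mul, coeff_v_mul, hb, hb',
    exponentSum_mul, framedHomfly]
  split_ifs with h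
  · obtain ⟨f, hf, h0, hfu⟩ := h.choose_spec.exists_isFramedMarkovTrace
    obtain ⟨m, rfl⟩ := Nat.exists_eq_add_of_le' hn
    rw [hfu, hfu, hb, hb', exponentSum_halfTwist_sq]
    have hm (k : ℤ) (hk : 0 < |k|) : (f 0 1).coeff k = 0 := by
      rw [h0, ← LaurentPolynomial.T_zero, LaurentPolynomial.T_apply, if_neg]
      rintro rfl
      simp at hk
    -- Dividing by v to the writhe recenters the degrees at 0, where they become the extremes -m and
    -- m.
    have e1 : exponentSum β - (m + 1 : ℕ) + 1 - exponentSum β = -m := by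
      push_cast
      ring
    have e2 : exponentSum β + ((m + 1 : ℕ) : ℤ) ^ 2 - 1 - (exponentSum β + m * (m + 1)) = m := by
      push_cast
      ring
    rw [e1, e2]
    exact hf.coeff_halfTwist_sq hm β
  -- With the default value 0 of `framedHomfly` both coefficients vanish.
  · exact (mul_zero _).symm
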